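/- Let $d,k\ge 0$ be integers, let $\mathcal I=\{1,\dots,d\}$, and let $\Lambda\subseteq\mathcal I^{\mathbb Z}$ be a $k$-step subshift of finite type, i.e. for some finite set $W$ of words of length at most $k+1$, $\Lambda$ is the set of all two-sided sequences in which no word of $W$ occurs as a block. Let $\Lambda^n$ be the set of words of length $n$ that occur in some $x\in\Lambda$, let $\Lambda^*=\bigcup_{n\ge0}\Lambda^n$, and put $E_i^k=\{\alpha\in\Lambda^k : i\alpha\in\Lambda^*\}$ for $i\in\mathcal I$. Let $E=\mathbb C^d$ with orthonormal basis $e_1,\dots,e_d$, and write $e_\alpha=e_{\alpha_1}\otimes\cdots\otimes e_{\alpha_n}\in E^{\otimes n}$ for a word $\alpha=\alpha_1\cdots\alpha_n$. Let $X=X_\Lambda$ be the subproduct system with $X(0)=\mathbb C$ and $X(n)=\operatorname{span}\{e_\alpha:\alpha\in\Lambda^n\}\subseteq E^{\otimes n}$ for $n\ge1$, let $\mathfrak F_X=\bigoplus_{n\ge0}X(n)$ be its Fock space, and let $S_1,\dots,S_d\in B(\mathfrak F_X)$ be the $X$-shift: $S_ie_\alpha=e_{i\alpha}$ if $i\alpha\in\Lambda^*$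 and $S_ie_\alpha=0$ otherwise. Let $\mathcal T_X$ be the unital C$^*$-algebra generated by $S_1,\dots,S_d$, let $\mathcal O_\Lambda=\mathcal T_X/\mathcal K(\mathfrak F_X)$ be its quotient by the compact operators, and let $Z_i$ be the image of $S_i$ in $\mathcal O_\Lambda$. Let $I^X$ be the linear span of those noncommutative polynomials $p=\sum_\alpha c_\alpha x^\alpha\in\mathbb C\langle x_1,\dots,x_d\rangle$ for which $\sum_\alpha c_\alpha e_\alpha\in E^{\otimes n}\ominus X(n)$ for some $n>0$. For a tuple $T=(T_1,\dots,T_d)$ of bounded operators on a complex Hilbert space $H$, with $T^\alpha=T_{\alpha_1}\cdots T_{\alpha_n}$ and $T^\emptyset=1$, consider the relations - (Z1) $p(T)=0$ for all $p\in I^X$; - (Z2) $T_i^*T_j=0$ for all $i\ne j$; - (Z3) $\sum_{i=1}^dT_iT_i^*=1$; - (Z4) $T_i^*T_i=\sum_{\alpha\in E_i^k}T^\alpha T^{\alpha*}$ for all $i$. **Theorem.** Let $H$ be a complex Hilbert space. 1. For every unital $*$-representation $\pi:\mathcal O_\Lambda\to B(H)$ there is a row contraction $T=(T_1,\dots,T_d)$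 on $H$ (that is, $\sum_iT_iT_i^*\le1$) that satisfies (Z1)–(Z4), such that $\pi(Z_i)=T_i$ for all $i$, and $\pi$ is determined by $T$: every unital $*$-representation $\rho:\mathcal O_\Lambda\to B(H)$ with $\rho(Z_i)=T_i$ for all $i$ equals $\pi$. 2. Conversely, for every row contraction $T=(T_1,\dots,T_d)$ on $H$ that satisfies (Z1)–(Z4) there is a unique unital $*$-representation $\pi:\mathcal O_\Lambda\to B(H)$ such that $\pi(Z_i)=T_i$ for all $i$. -/

import Mathlib

noncomputable section

namespace SubshiftAlgebra

open SymbolicDynamics.FullShift (Subshift)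

/-! ### Words, subshifts of finite type, and the language of a subshift

The alphabet is `Fin d`, words are lists of letters, and `Subshift (Fin d) ℤ` is the type of closed
shift invariant sets of two-sided sequences `ℤ → Fin d`. -/

/-- The word `w` occurs as a block in the two-sided sequence `x`. -/
def OccursIn {d : ℕ} (w : List (Fin d)) (x : ℤ → Fin d) : Prop :=
  ∃ m : ℤ, ∀ (j : ℕ) (hj : j < w.length), x (m + (j : ℤ)) = w[j]

/-- `Λ_W`: the sequences in which no word of `W` occurs. -/
def avoiding {d : ℕ} (W : Set (List (Fin d))) : Set (ℤ → Fin d) :=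
  {x | ∀ w ∈ W, ¬ OccursIn w x}

/-- `Λ` is a `k`-step subshift of finite type: `Λ = Λ_W` for a finite set `W` of forbidden words of
length at most `k + 1`. (The full shift, `W = ∅`, is `k`-step for every `k`.) -/
def IsStepSFT {d : ℕ} (k : ℕ) (Λ : Subshift (Fin d) ℤ) : Prop :=
  ∃ W : Set (List (Fin d)), W.Finite ∧ (∀ w ∈ W, w.length ≤ k + 1) ∧ Λ.carrier = avoiding W

/-- `Λ^*`: the words that occur in some sequence of `Λ`. -/
def language {d : ℕ} (Λ : Subshift (Fin d) ℤ) : Set (List (Fin d)) :=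
  {α | ∃ x ∈ Λ.carrier, OccursIn α x}

/-- `Λ^n`: the words of length `n` that occur in some sequence of `Λ`. -/
def languageOfLength {d : ℕ} (Λ : Subshift (Fin d) ℤ) (n : ℕ) : Set (List (Fin d)) :=
  {α | α ∈ language Λ ∧ α.length = n}

theorem finite_followers {d : ℕ} (Λ : Subshift (Fin d) ℤ) (i : Fin d) (k : ℕ) :
    {α | α ∈ languageOfLength Λ k ∧ i :: α ∈ language Λ}.Finite :=
  (List.finite_length_eq (Fin d) k).subset fun _ hα => hα.1.2

/-- `E_i^k`: the words `α ∈ Λ^k` such that `iα ∈ Λ^*`. -/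
def followers {d : ℕ} (Λ : Subshift (Fin d) ℤ) (i : Fin d) (k : ℕ) : Finset (List (Fin d)) :=
  (finite_followers Λ i k).toFinset

/-! ### The Fock space of the subproduct system of a subshift -/

/-- The full Fock space `⨁ₙ E^{⊗n}` of `E = ℂ^d`, as the Hilbert space with orthonormal basis
`e_α = e_{α₁} ⊗ ⋯ ⊗ e_{αₙ}`, where `α` ranges over all words. -/
abbrev FullFock (d : ℕ) : Type := lp (fun _ : List (Fin d) => ℂ) 2

/-- The basis vector `e_α`; `e_∅` is the vacuum vector. -/
def e {d : ℕ} (α : List (Fin d)) : FullFock d := lp.single 2 α (1 : ℂ)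

theorem orthonormal_e (d : ℕ) : Orthonormal ℂ (e : List (Fin d) → FullFock d) := by
  rw [orthonormal_iff_ite]
  intro α β
  rw [e, e, lp.inner_single_left]
  by_cases h : α = β
  · subst h; simp
  · simp [h]

/-- `E^{⊗n}` inside the full Fock space. -/
def tensorPower (d n : ℕ) : Submodule ℂ (FullFock d) :=
  Submodule.span ℂ (e '' {α | α.length = n})

/-- The fibers `X_Λ(n) ⊆ E^{⊗n}` of the subproduct system of `Λ`: `X_Λ(0) = ℂ` (spanned by the
vacuum), and `X_Λ(n) = span {e_α : α ∈ Λ^n}` for `n ≥ 1`. -/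
def fiber {d : ℕ} (Λ : Subshift (Fin d) ℤ) : ℕ → Submodule ℂ (FullFock d)
  | 0 => tensorPower d 0
  | n + 1 => Submodule.span ℂ (e '' languageOfLength Λ (n + 1))

/-- The Fock space `𝔉_X = ⨁ₙ X_Λ(n)`, as a closed subspace of the full Fock space. -/
def fockSubspace {d : ℕ} (Λ : Subshift (Fin d) ℤ) : Submodule ℂ (FullFock d) :=
  (⨆ n, fiber Λ n).topologicalClosure

instance {d : ℕ} (Λ : Subshift (Fin d) ℤ) : CompleteSpace (fockSubspace Λ) :=
  Submodule.topologicalClosure.completeSpace _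

/-- The Hilbert space `𝔉_X`. -/
def Fock {d : ℕ} (Λ : Subshift (Fin d) ℤ) : Type := fockSubspace Λ

instance {d : ℕ} (Λ : Subshift (Fin d) ℤ) : NormedAddCommGroup (Fock Λ) :=
  inferInstanceAs (NormedAddCommGroup (fockSubspace Λ))

instance {d : ℕ} (Λ : Subshift (Fin d) ℤ) : InnerProductSpace ℂ (Fock Λ) :=
  inferInstanceAs (InnerProductSpace ℂ (fockSubspace Λ))

instance {d : ℕ} (Λ : Subshift (Fin d) ℤ) : CompleteSpace (Fock Λ) :=
  inferInstanceAs (CompleteSpace (fockSubspace Λ))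

/-- The inclusion of `𝔉_X` in the full Fock space. -/
def fockIncl {d : ℕ} (Λ : Subshift (Fin d) ℤ) : Fock Λ →ₗᵢ[ℂ] FullFock d :=
  (fockSubspace Λ).subtypeₗᵢ

/-- The orthogonal projection of the full Fock space onto `𝔉_X`. -/
def fockProj {d : ℕ} (Λ : Subshift (Fin d) ℤ) : FullFock d →L[ℂ] Fock Λ :=
  (fockSubspace Λ).orthogonalProjectionOnto

/-- The algebra `B(𝔉_X)`. -/
abbrev FockOp {d : ℕ} (Λ : Subshift (Fin d) ℤ) : Type := Fock Λ →L[ℂ] Fock Λ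

theorem orthonormal_e_cons {d : ℕ} (i : Fin d) :
    Orthonormal ℂ (fun α : List (Fin d) => (e (i :: α) : FullFock d)) :=
  (orthonormal_e d).comp (fun α => i :: α) (List.cons_injective)

/-- The left creation operator `x ↦ e_i ⊗ x` on the full Fock space: the isometry that maps `e_α`
to `e_{iα}`. -/
def creation {d : ℕ} (i : Fin d) : FullFock d →L[ℂ] FullFock d :=
  (orthonormal_e_cons i).orthogonalFamily.linearIsometry.toContinuousLinearMap

theorem creation_e {d : ℕ} (i : Fin d) (α : List (Fin d)) : creation i (e α) = e (i :: α) := by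
  simp [creation, e]

/-- The `X`-shift `S_i`, where `S_i x = U_{1,n}(e_i ⊗ x)` for `x ∈ X_Λ(n)`. Since the product
`U_{1,n}` is the restriction of the projection onto `X_Λ(n + 1)`, this is the compression of the
creation operator to `𝔉_X`; see `xShift_apply` for its values on the basis. -/
def xShift {d : ℕ} (Λ : Subshift (Fin d) ℤ) (i : Fin d) : FockOp Λ :=
  fockProj Λ ∘L creation i ∘L (fockIncl Λ).toContinuousLinearMap

theorem e_mem_fock {d : ℕ} (Λ : Subshift (Fin d) ℤ) {α : List (Fin d)} (hα : α ∈ language Λ) :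
    e α ∈ fockSubspace Λ := by
  refine Submodule.le_topologicalClosure _ (Submodule.mem_iSup_of_mem α.length ?_)
  cases α with
  | nil => exact Submodule.subset_span ⟨_, rfl, rfl⟩
  | cons i α => exact Submodule.subset_span ⟨_, ⟨hα, rfl⟩, rfl⟩

theorem e_mem_fock_orthogonal {d : ℕ} (Λ : Subshift (Fin d) ℤ) {α : List (Fin d)}
    (hα : α ∉ language Λ) (hne : α ≠ []) : e α ∈ (fockSubspace Λ)ᗮ := by
  rw [fockSubspace, Submodule.orthogonal_closure, ← Submodule.iInf_orthogonal, Submodule.mem_iInf]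
  intro n
  have key : ∀ s : Set (List (Fin d)), α ∉ s → e α ∈ (Submodule.span ℂ (e '' s))ᗮ := by
    intro s hs
    rw [Submodule.mem_orthogonal]
    intro u hu
    induction hu using Submodule.span_induction with
    | mem x hx =>
      obtain ⟨β, hβ, rfl⟩ := hx
      exact (orthonormal_e d).2 (fun h => hs (h ▸ hβ))
    | zero => simp
    | add x y _ _ hx hy => rw [inner_add_left, hx, hy, add_zero]
    | smul c x _ hx => rw [inner_smul_left, hx, mul_zero]
  cases n with
  | zero => exact key _ (fun h => hne (List.length_eq_zero_iff.mp h))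
  | succ n => exact key _ (fun h => hα h.1)

open Classical in
/-- `S_i e_α = e_{iα}` if `iα ∈ Λ^*`, and `S_i e_α = 0` otherwise. -/
theorem xShift_apply {d : ℕ} (Λ : Subshift (Fin d) ℤ) (i : Fin d) (α : List (Fin d)) (x : Fock Λ)
    (hx : fockIncl Λ x = e α) :
    fockIncl Λ (xShift Λ i x) = if i :: α ∈ language Λ then e (i :: α) else 0 := by
  have h : xShift Λ i x = fockProj Λ (e (i :: α)) := by
    simp [xShift, hx, creation_e]
  rw [h]
  split_ifs with hα
  · exact Submodule.starProjection_eq_self_iff.mpr (e_mem_fock Λ hα)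
  · have h0 : fockProj Λ (e (i :: α)) = 0 :=
      Submodule.orthogonalProjectionOnto_apply_of_mem_orthogonal
        (e_mem_fock_orthogonal Λ hα (List.cons_ne_nil _ _))
    rw [h0, map_zero]

/-! ### The C*-algebra `O_Λ = T_X / K(𝔉_X)` -/

/-- Adjoints of compact operators on Hilbert spaces are compact. -/
theorem isCompactOperator_star {K : Type*} [NormedAddCommGroup K] [InnerProductSpace ℂ K]
    [CompleteSpace K] {a : K →L[ℂ] K} (ha : IsCompactOperator a) :
    IsCompactOperator (star a : K →L[ℂ] K) := by
  have hc : IsCompactOperator (a * star a : K →L[ℂ] K) := ha.comp_clm (star a : K →L[ℂ] K)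
  have h1 : TotallyBounded ((a * star a : K →L[ℂ] K) '' Metric.ball 0 1) :=
    (hc.isCompact_closure_image_ball (f := ((a * star a : K →L[ℂ] K) : K →ₗ[ℂ] K))
      1).totallyBounded.subset subset_closure
  refine (isCompactOperator_iff_isCompact_closure_image_ball
    ((star a : K →L[ℂ] K) : K →ₗ[ℂ] K) one_pos).mpr ?_
  refine TotallyBounded.isCompact_of_isClosed (TotallyBounded.closure ?_) isClosed_closure
  rw [Metric.totallyBounded_iff]
  intro ε hε
  obtain ⟨t, hts, htf, hcov⟩ :=
    Metric.finite_approx_of_totallyBounded h1 (ε ^ 2 / 2) (by positivity)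
  obtain ⟨u, hub, huf, rfl⟩ := Set.exists_subset_image_finite_and.mp ⟨t, hts, htf, rfl⟩
  refine ⟨(star a : K →L[ℂ] K) '' u, huf.image _, ?_⟩
  rintro _ ⟨x, hx, rfl⟩
  have := hcov (Set.mem_image_of_mem _ hx)
  simp only [Set.mem_iUnion, Set.mem_image, exists_prop] at this ⊢
  obtain ⟨_, ⟨y, hy, rfl⟩, hxy⟩ := this
  refine ⟨_, ⟨y, hy, rfl⟩, ?_⟩
  have hy1 := hub hy
  rw [Metric.mem_ball, dist_eq_norm] at hxy ⊢
  rw [mem_ball_zero_iff] at hx hy1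
  rw [← map_sub] at hxy
  have hz : ‖x - y‖ < 2 := (norm_sub_le x y).trans_lt (by linarith)
  have hsq : ‖(star a : K →L[ℂ] K) (x - y)‖ ^ 2
      ≤ ‖(a * star a : K →L[ℂ] K) (x - y)‖ * ‖x - y‖ := by
    have h := ContinuousLinearMap.apply_norm_sq_eq_inner_adjoint_left (star a : K →L[ℂ] K) (x - y)
    rw [← ContinuousLinearMap.star_eq_adjoint, star_star] at h
    rw [h]
    exact (Complex.re_le_norm _).trans (norm_inner_le_norm _ _)
  have hlt : ‖(star a : K →L[ℂ] K) (x - y)‖ ^ 2 < ε ^ 2 := by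
    nlinarith [norm_nonneg (x - y), mul_le_mul_of_nonneg_right hxy.le (norm_nonneg (x - y)),
      sq_pos_of_pos hε]
  have := lt_of_pow_lt_pow_left₀ 2 hε.le hlt
  rwa [map_sub] at this

section Quotient

variable {K : Type*} [NormedAddCommGroup K] [InnerProductSpace ℂ K] [CompleteSpace K]

/-- The unital C*-algebra generated by a family of operators. -/
def generatedCStar {ι : Type*} (S : ι → K →L[ℂ] K) : StarSubalgebra ℂ (K →L[ℂ] K) :=
  (StarAlgebra.adjoin ℂ (Set.range S)).topologicalClosure

theorem mem_generatedCStar {ι : Type*} (S : ι → K →L[ℂ] K) (i : ι) : S i ∈ generatedCStar S :=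
  StarSubalgebra.le_topologicalClosure _ (StarAlgebra.subset_adjoin ℂ _ (Set.mem_range_self i))

variable (A : StarSubalgebra ℂ (K →L[ℂ] K))

/-- The two-sided ideal of the compact operators in a unital *-algebra `A` of operators. -/
def compactIdeal : Ideal A where
  carrier := {a | IsCompactOperator (a : K →L[ℂ] K)}
  add_mem' ha hb := IsCompactOperator.add ha hb
  zero_mem' := isCompactOperator_zero
  smul_mem' c _ ha := IsCompactOperator.clm_comp ha (c : K →L[ℂ] K)

instance : (compactIdeal A).IsTwoSided where
  mul_mem_of_left b ha := IsCompactOperator.comp_clm ha (b : K →L[ℂ] K)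

/-- The quotient of `A` by its ideal of compact operators. -/
def ModCompact : Type _ := A ⧸ compactIdeal A

instance : Ring (ModCompact A) := inferInstanceAs (Ring (A ⧸ compactIdeal A))

instance : Algebra ℂ (ModCompact A) := inferInstanceAs (Algebra ℂ (A ⧸ compactIdeal A))

/-- The quotient map. -/
def quotientMap : A →ₐ[ℂ] ModCompact A := Ideal.Quotient.mkₐ ℂ (compactIdeal A)

theorem quotientMap_surjective : Function.Surjective (quotientMap A) :=
  Ideal.Quotient.mk_surjective

/-- The involution of the quotient, `(a + K)^* = a^* + K`. -/
instance : Star (ModCompact A) where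
  star := Quotient.map (sa := (compactIdeal A).quotientRel) (sb := (compactIdeal A).quotientRel)
    star fun a b hab => by
      have h : IsCompactOperator ((a - b : A) : K →L[ℂ] K) :=
        (Submodule.quotientRel_def _).mp hab
      refine (Submodule.quotientRel_def _).mpr ?_
      have h' : star a - star b = star (a - b) := (star_sub a b).symm
      rw [h']
      exact isCompactOperator_star h

theorem quotientMap_star (a : A) : quotientMap A (star a) = star (quotientMap A a) := rfl

instance : StarRing (ModCompact A) where
  star_involutive x := by
    obtain ⟨a, rfl⟩ := quotientMap_surjective A x
    rw [← quotientMap_star, ← quotientMap_star, star_star]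
  star_mul x y := by
    obtain ⟨a, rfl⟩ := quotientMap_surjective A x
    obtain ⟨b, rfl⟩ := quotientMap_surjective A y
    rw [← map_mul, ← quotientMap_star, ← quotientMap_star, ← quotientMap_star, star_mul, map_mul]
  star_add x y := by
    obtain ⟨a, rfl⟩ := quotientMap_surjective A x
    obtain ⟨b, rfl⟩ := quotientMap_surjective A y
    rw [← map_add, ← quotientMap_star, ← quotientMap_star, ← quotientMap_star, star_add, map_add]

instance : StarModule ℂ (ModCompact A) where
  star_smul c x := by
    obtain ⟨a, rfl⟩ := quotientMap_surjective A x
    rw [← map_smul, ← quotientMap_star, ← quotientMap_star, star_smul, map_smul]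

end Quotient

/-- `T_X`: the unital C*-algebra generated by the `X`-shift. -/
def toeplitz {d : ℕ} (Λ : Subshift (Fin d) ℤ) : StarSubalgebra ℂ (FockOp Λ) :=
  generatedCStar (xShift Λ)

/-- `O_Λ = T_X / K(𝔉_X)`. (The algebra `T_X` contains all compact operators on `𝔉_X`.) -/
abbrev SubshiftAlg {d : ℕ} (Λ : Subshift (Fin d) ℤ) : Type := ModCompact (toeplitz Λ)

/-- `Z_i`: the image of `S_i` in `O_Λ`. -/
def Z {d : ℕ} (Λ : Subshift (Fin d) ℤ) (i : Fin d) : SubshiftAlg Λ :=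
  quotientMap (toeplitz Λ) ⟨xShift Λ i, mem_generatedCStar (xShift Λ) i⟩

/-! ### The relations -/

/-- `p(e) = ∑ c_α e_α` for a noncommutative polynomial `p = ∑ c_α x^α`. -/
def polyVector (d : ℕ) : FreeAlgebra ℂ (Fin d) →ₗ[ℂ] FullFock d :=
  (FreeAlgebra.basisFreeMonoid ℂ (Fin d)).constr ℂ
    (fun α : FreeMonoid (Fin d) => e (FreeMonoid.toList α))

/-- The ideal `I^X` of `X_Λ`, the span of all polynomials `p` such that `p(e)` lies in
`E^{⊗n} ⊖ X_Λ(n)` for some `n > 0`. -/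
def idealOf {d : ℕ} (Λ : Subshift (Fin d) ℤ) : Submodule ℂ (FreeAlgebra ℂ (Fin d)) :=
  Submodule.span ℂ {p | ∃ n : ℕ, 0 < n ∧ polyVector d p ∈ tensorPower d n ⊓ (fiber Λ n)ᗮ}

/-- `T^α = T_{α₁} ⋯ T_{αₙ}`, with `T^∅ = 1`. -/
def wordProd {d : ℕ} {A : Type*} [Monoid A] (T : Fin d → A) (α : List (Fin d)) : A :=
  (α.map T).prod

/-- The relations (Z1)-(Z4) of the generators of `O_Λ` for a `k`-step subshift of finite type. -/
structure SatisfiesRelations {d : ℕ} (Λ : Subshift (Fin d) ℤ) (k : ℕ) {A : Type*} [Ring A]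
    [Algebra ℂ A] [Star A] (T : Fin d → A) : Prop where
  /-- `p(T) = 0` for all `p ∈ I^X`. -/
  ideal_eq_zero : ∀ p ∈ idealOf Λ, FreeAlgebra.lift ℂ T p = 0
  /-- `T_i^* T_j = 0` for `i ≠ j`. -/
  star_mul_eq_zero : ∀ i j, i ≠ j → star (T i) * T j = 0
  /-- `∑ T_i T_i^* = 1`. -/
  sum_mul_star : ∑ i, T i * star (T i) = 1
  /-- `T_i^* T_i = ∑_{α ∈ E_i^k} T^α (T^α)^*`. -/
  star_mul_self : ∀ i,
    star (T i) * T i = ∑ α ∈ followers Λ i k, wordProd T α * star (wordProd T α)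

/-- `T` is a row contraction: `∑ T_i T_i^* ≤ 1`. -/
def IsRowContraction {d : ℕ} {H : Type*} [NormedAddCommGroup H] [InnerProductSpace ℂ H]
    [CompleteSpace H] (T : Fin d → H →L[ℂ] H) : Prop :=
  ∑ i, T i * star (T i) ≤ 1

end SubshiftAlgebra

end

noncomputable section

namespace SubshiftAlgebra

open SymbolicDynamics.FullShift (Subshift)
open Filter Topology
open scoped TensorProduct CStarAlgebra

/-! ### Asymptotic intertwiners -/

section Intertwine

variable {K H : Type*} [NormedAddCommGroup K] [InnerProductSpace ℂ K]
  [NormedAddCommGroup H] [InnerProductSpace ℂ H]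

/-- The maps `V_N : H → K ⊗ H` asymptotically intertwine `b` and `a ⊗ 1`. -/
def AsympIntertwines (V : ℕ → H →ₗ[ℂ] K ⊗[ℂ] H) (a : K →L[ℂ] K) (b : H →L[ℂ] H) : Prop :=
  ∀ h, Tendsto (fun N => a.rTensor H (V N h) - V N (b h)) atTop (𝓝 0)

namespace AsympIntertwines

variable {V : ℕ → H →ₗ[ℂ] K ⊗[ℂ] H} {a a' : K →L[ℂ] K} {b b' : H →L[ℂ] H}

theorem add (h : AsympIntertwines V a b) (h' : AsympIntertwines V a' b') :
    AsympIntertwines V (a + a') (b + b') := fun x => by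
  have := (h x).add (h' x)
  rw [add_zero] at this
  refine this.congr fun N => ?_
  rw [ContinuousLinearMap.rTensor_add, add_apply, add_apply, map_add]
  abel

theorem smul (c : ℂ) (h : AsympIntertwines V a b) : AsympIntertwines V (c • a) (c • b) :=
  fun x => by
  have := (h x).const_smul c
  rw [smul_zero] at this
  refine this.congr fun N => ?_
  rw [ContinuousLinearMap.rTensor_smul, smul_apply, smul_apply, map_smul, smul_sub]

theorem sub (h : AsympIntertwines V a b) (h' : AsympIntertwines V a' b') :
    AsympIntertwines V (a - a') (b - b') := by
  simpa [sub_eq_add_neg] using h.add (h'.smul (-1))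

theorem one : AsympIntertwines V 1 1 := fun x => by simp

/-- The error splits as `(a ⊗ 1)((a' ⊗ 1) V - V b') + ((a ⊗ 1) V - V b) b'`. -/
theorem mul (h : AsympIntertwines V a b) (h' : AsympIntertwines V a' b') :
    AsympIntertwines V (a * a') (b * b') := fun x => by
  have := (((a.rTensor H).continuous.tendsto 0).comp (h' x)).add (h (b' x))
  rw [map_zero, add_zero] at this
  refine this.congr fun N => ?_
  rw [ContinuousLinearMap.rTensor_mul, mul_apply_eq_comp, mul_apply_eq_comp, Function.comp_apply,
    map_sub]
  abel

/-- Since `V N` is isometric, `‖b x‖ = ‖V N (b x)‖` is at most `‖a‖ ‖x‖` plus an error that tends to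
zero. Uniqueness of `b` and its continuous dependence on `a` both follow from this bound. -/
theorem norm_le (hV : ∀ N h, ‖V N h‖ = ‖h‖) (h : AsympIntertwines V a b) :
    ‖b‖ ≤ ‖a‖ := by
  refine b.opNorm_le_bound (norm_nonneg _) fun x => ?_
  have h1 := (h x).norm
  rw [norm_zero] at h1
  have h2 := h1.const_add (‖a‖ * ‖x‖)
  rw [add_zero] at h2
  refine ge_of_tendsto' h2 fun N => ?_
  have h3 : ‖a.rTensor H (V N x)‖ ≤ ‖a‖ * ‖x‖ := by
    rw [← hV N x]
    exact (ContinuousLinearMap.le_opNorm _ _).trans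
      (mul_le_mul_of_nonneg_right (ContinuousLinearMap.norm_rTensor_le _ a) (norm_nonneg _))
  calc ‖b x‖ = ‖V N (b x)‖ := (hV N _).symm
    _ ≤ ‖a.rTensor H (V N x)‖ + ‖a.rTensor H (V N x) - V N (b x)‖ := norm_le_insert _ _
    _ ≤ _ := by gcongr

theorem of_tendsto (hV : ∀ N h, ‖V N h‖ = ‖h‖) {u : ℕ → K →L[ℂ] K} {v : ℕ → H →L[ℂ] H}
    (hu : Tendsto u atTop (𝓝 a))
    (hv : Tendsto v atTop (𝓝 b))
    (h : ∀ n, AsympIntertwines V (u n) (v n)) :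
    AsympIntertwines V a b := fun x => by
  rw [Metric.tendsto_atTop]
  intro ε hε
  have h1 : Tendsto (fun n => ‖a - u n‖ * ‖x‖ + ‖v n x - b x‖) atTop (𝓝 0) := by
    have e1 : Tendsto (fun n => ‖a - u n‖) atTop (𝓝 0) := by
      simpa using (tendsto_const_nhds (x := a)).sub hu |>.norm
    have e2 : Tendsto (fun n => v n x) atTop (𝓝 (b x)) :=
      ((ContinuousLinearMap.apply ℂ H x).continuous.tendsto b).comp hv
    have e3 : Tendsto (fun n => ‖v n x - b x‖) atTop (𝓝 0) := by
      simpa using (e2.sub_const (b x)).norm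
    simpa using (e1.mul_const ‖x‖).add e3
  obtain ⟨n, hn⟩ := (h1.eventually (gt_mem_nhds (half_pos hε))).exists
  obtain ⟨N₀, hN₀⟩ := Metric.tendsto_atTop.mp (h n x) (ε / 2) (half_pos hε)
  refine ⟨N₀, fun N hN => ?_⟩
  have h2 := hN₀ N hN
  rw [dist_zero_right] at h2 ⊢
  have h3 : ‖(a - u n).rTensor H (V N x)‖ ≤ ‖a - u n‖ * ‖x‖ := by
    rw [← hV N x]
    exact (ContinuousLinearMap.le_opNorm _ _).trans
      (mul_le_mul_of_nonneg_right (ContinuousLinearMap.norm_rTensor_le _ _) (norm_nonneg _))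
  have h4 : ‖V N (v n x - b x)‖ = ‖v n x - b x‖ := hV _ _
  -- The first two terms are small uniformly in `N`, because `V N` is isometric; only the third
  -- needs `N` large.
  have h5 : a.rTensor H (V N x) - V N (b x) = (a - u n).rTensor H (V N x)
      + V N (v n x - b x) + ((u n).rTensor H (V N x) - V N (v n x)) := by
    rw [ContinuousLinearMap.rTensor_sub, sub_apply, map_sub]
    abel
  rw [h5]
  refine (norm_add₃_le).trans_lt ?_
  linarith

theorem unique (hV : ∀ N h, ‖V N h‖ = ‖h‖) (h : AsympIntertwines V a b)
    (h' : AsympIntertwines V a b') : b = b' := by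
  have := (h.sub h').norm_le hV
  rw [sub_self, norm_zero] at this
  exact sub_eq_zero.mp (norm_le_zero_iff.mp this)

theorem norm_sub_le (hV : ∀ N h, ‖V N h‖ = ‖h‖) (h : AsympIntertwines V a b)
    (h' : AsympIntertwines V a' b') :
    ‖b - b'‖ ≤ ‖a - a'‖ := (h.sub h').norm_le hV

end AsympIntertwines

/-! ### Intertwining of adjoints and the resulting representation -/

variable [CompleteSpace K] [CompleteSpace H]

/-- Both `b`, `a ⊗ 1` and their adjoints are asymptotically intertwined by `V_N`. -/
def StarIntertwines (V : ℕ → H →ₗ[ℂ] K ⊗[ℂ] H) (a : K →L[ℂ] K) (b : H →L[ℂ] H) : Prop :=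
  AsympIntertwines V a b ∧ AsympIntertwines V (star a) (star b)

namespace StarIntertwines

variable {V : ℕ → H →ₗ[ℂ] K ⊗[ℂ] H} {a a' : K →L[ℂ] K} {b b' : H →L[ℂ] H}

theorem add (h : StarIntertwines V a b) (h' : StarIntertwines V a' b') :
    StarIntertwines V (a + a') (b + b') :=
  ⟨h.1.add h'.1, by rw [star_add, star_add]; exact h.2.add h'.2⟩

theorem scalar (c : ℂ) :
    StarIntertwines V (algebraMap ℂ (K →L[ℂ] K) c) (algebraMap ℂ (H →L[ℂ] H) c) := by
  rw [Algebra.algebraMap_eq_smul_one, Algebra.algebraMap_eq_smul_one]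
  refine ⟨AsympIntertwines.one.smul c, ?_⟩
  rw [star_smul, star_smul, star_one, star_one]
  exact AsympIntertwines.one.smul _

theorem star (h : StarIntertwines V a b) : StarIntertwines V (star a) (star b) :=
  ⟨h.2, by rw [star_star, star_star]; exact h.1⟩

theorem mul (h : StarIntertwines V a b)
    (h' : StarIntertwines V a' b') : StarIntertwines V (a * a') (b * b') :=
  ⟨h.1.mul h'.1, by rw [star_mul, star_mul]; exact h'.2.mul h.2⟩

/-- The unital *-algebra of all operators that admit an intertwined operator. -/
def domain (V : ℕ → H →ₗ[ℂ] K ⊗[ℂ] H) : StarSubalgebra ℂ (K →L[ℂ] K) where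
  carrier := {a | ∃ b, StarIntertwines V a b}
  mul_mem' := fun ⟨_, hb⟩ ⟨_, hb'⟩ => ⟨_, hb.mul hb'⟩
  add_mem' := fun ⟨_, hb⟩ ⟨_, hb'⟩ => ⟨_, hb.add hb'⟩
  algebraMap_mem' c := ⟨_, scalar c⟩
  star_mem' := fun ⟨_, hb⟩ => ⟨_, hb.star⟩

/-- The contraction estimate makes the partners of a convergent sequence Cauchy; their limit is a
partner of the limit. -/
theorem isClosed_domain (hV : ∀ N h, ‖V N h‖ = ‖h‖) :
    IsClosed (domain V : Set (K →L[ℂ] K)) := by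
  refine IsSeqClosed.isClosed fun u a hu ha => ?_
  choose v hv using hu
  have hc : CauchySeq v := by
    rw [Metric.cauchySeq_iff']
    intro ε hε
    obtain ⟨N, hN⟩ := Metric.cauchySeq_iff'.mp ha.cauchySeq ε hε
    refine ⟨N, fun n hn => lt_of_le_of_lt ?_ (hN n hn)⟩
    rw [dist_eq_norm, dist_eq_norm]
    exact (hv n).1.norm_sub_le hV (hv N).1
  obtain ⟨b, hb⟩ := cauchySeq_tendsto_of_complete hc
  exact ⟨b, AsympIntertwines.of_tendsto hV ha hb fun n => (hv n).1,
    AsympIntertwines.of_tendsto hV ((continuous_star.tendsto a).comp ha)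
      ((continuous_star.tendsto b).comp hb) fun n => (hv n).2⟩

/-- Intertwined families of operators give a representation of the generated C*-algebra. -/
theorem exists_starAlgHom {ι : Type*} (hV : ∀ N h, ‖V N h‖ = ‖h‖) {S : ι → K →L[ℂ] K}
    {T : ι → H →L[ℂ] H} (hST : ∀ i, StarIntertwines V (S i) (T i)) :
    ∃ φ : generatedCStar S →⋆ₐ[ℂ] (H →L[ℂ] H),
      (∀ i, φ ⟨S i, mem_generatedCStar S i⟩ = T i) ∧
      ∀ a : generatedCStar S, AsympIntertwines V (a : K →L[ℂ] K) (φ a) := by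
  have hle : generatedCStar S ≤ domain V := by
    refine StarSubalgebra.topologicalClosure_minimal ?_ (isClosed_domain hV)
    refine StarAlgebra.adjoin_le ?_
    rintro _ ⟨i, rfl⟩
    exact ⟨T i, hST i⟩
  have hex : ∀ a : generatedCStar S, ∃ b, StarIntertwines V (a : K →L[ℂ] K) b :=
    fun a => hle a.2
  choose f hf using hex
  -- Uniqueness of the partner turns the arbitrary choice `f` into a *-homomorphism: each algebraic
  -- identity holds because both sides are partners of the same operator.
  have huniq : ∀ (a : generatedCStar S) b, StarIntertwines V (a : K →L[ℂ] K) b → f a = b :=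
    fun a b hb => (hf a).1.unique hV hb.1
  have halg : ∀ c : ℂ, f (algebraMap ℂ _ c) = algebraMap ℂ _ c :=
    fun c => huniq _ _ (scalar c)
  have hone : f 1 = 1 := by rw [← map_one (algebraMap ℂ _), halg, map_one]
  have hzero : f 0 = 0 := by rw [← map_zero (algebraMap ℂ _), halg, map_zero]
  have hmul : ∀ a a', f (a * a') = f a * f a' := fun a a' => huniq _ _ ((hf a).mul (hf a'))
  have hadd : ∀ a a', f (a + a') = f a + f a' := fun a a' => huniq _ _ ((hf a).add (hf a'))
  have hstar : ∀ a, f (Star.star a) = Star.star (f a) := fun a => huniq _ _ (hf a).star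
  exact ⟨⟨⟨⟨⟨⟨f, hone⟩, hmul⟩, hzero, hadd⟩, halg⟩, hstar⟩, fun i => huniq _ _ (hST i),
    fun a => (hf a).1⟩

end StarIntertwines

end Intertwine

variable {d k : ℕ} {Λ : Subshift (Fin d) ℤ}

/-! ### The language -/

theorem OccursIn.of_append_left {α β : List (Fin d)} {x : ℤ → Fin d} (h : OccursIn (α ++ β) x) :
    OccursIn α x := by
  obtain ⟨m, hm⟩ := h
  refine ⟨m, fun j hj => ?_⟩
  rw [hm j (by simp; omega), List.getElem_append_left hj]

theorem OccursIn.of_append_right {α β : List (Fin d)} {x : ℤ → Fin d} (h : OccursIn (α ++ β) x) :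
    OccursIn β x := by
  obtain ⟨m, hm⟩ := h
  refine ⟨m + α.length, fun j hj => ?_⟩
  have := hm (α.length + j) (by simp; omega)
  rw [List.getElem_append_right (by omega)] at this
  simpa [add_assoc] using this

theorem language_of_append_left {α β : List (Fin d)} (h : α ++ β ∈ language Λ) : α ∈ language Λ :=
  let ⟨x, hx, ho⟩ := h
  ⟨x, hx, ho.of_append_left⟩

theorem language_of_append_right {α β : List (Fin d)} (h : α ++ β ∈ language Λ) :
    β ∈ language Λ :=
  let ⟨x, hx, ho⟩ := h
  ⟨x, hx, ho.of_append_right⟩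

theorem language_of_cons {i : Fin d} {β : List (Fin d)} (h : i :: β ∈ language Λ) :
    β ∈ language Λ :=
  language_of_append_right (α := [i]) h

/-- In a `k`-step subshift of finite type, words overlapping in `k` letters can be glued. -/
theorem IsStepSFT.cons_append_mem (hΛ : IsStepSFT k Λ) {i : Fin d} {α γ : List (Fin d)}
    (hα : α.length = k) (h₁ : i :: α ∈ language Λ) (h₂ : α ++ γ ∈ language Λ) :
    i :: (α ++ γ) ∈ language Λ := by
  obtain ⟨W, -, hW, hΛW⟩ := hΛ
  obtain ⟨y, hy, m', hm'⟩ := h₁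
  obtain ⟨x, hx, m, hm⟩ := h₂
  rw [hΛW] at hx hy
  -- Follow `y`, translated so that its letter `i` sits at position `m - 1`, up to the end of the
  -- overlap, and `x` afterwards. The two agree on the `k` positions from `m` on.
  let z : ℤ → Fin d := fun n => if n < m + k then y (n - m + m' + 1) else x n
  have hzx : ∀ n, m ≤ n → z n = x n := by
    intro n hn
    by_cases h : n < m + k
    · obtain ⟨j, rfl⟩ : ∃ j : ℕ, n = m + j := ⟨(n - m).toNat, by omega⟩
      have hj : j < α.length := by omega
      have h1 := hm' (j + 1) (by simp; omega)
      have h2 := hm j (by simp; omega)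
      rw [List.getElem_append_left hj] at h2
      rw [List.getElem_cons_succ] at h1
      simp only [z, if_pos h, h2, ← h1]
      congr 1
      push_cast
      ring
    · simp [z, h]
  have hzy : ∀ n, n < m + k → z n = y (n - m + m' + 1) := fun n hn => by simp [z, hn]
  refine ⟨z, ?_, m - 1, ?_⟩
  · rw [hΛW]
    rintro w hw ⟨s, hs⟩
    -- A forbidden word has at most `k + 1` letters, so one starting before `m` ends before `m + k`
    -- and lies in `y`; one starting at `m` or later lies in `x`.
    rcases le_or_gt m s with h | h
    · exact hx w hw ⟨s, fun j hj => by rw [← hs j hj, hzx _ (by omega)]⟩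
    · refine hy w hw ⟨s - m + m' + 1, fun j hj => ?_⟩
      have := hW w hw
      rw [← hs j hj, hzy _ (by omega)]
      congr 1
      ring
  · rintro (_ | j) hj
    · have := hm' 0 (by simp)
      rw [hzy _ (by omega)]
      simpa using this
    · have h2 := hm j (by simpa using hj)
      rw [List.getElem_cons_succ, ← h2, hzx _ (by push_cast; omega)]
      congr 1
      push_cast
      ring

theorem mem_followers {i : Fin d} {α : List (Fin d)} :
    α ∈ followers Λ i k ↔ α.length = k ∧ i :: α ∈ language Λ := by
  simp only [followers, Set.Finite.mem_toFinset, Set.mem_ofPred_eq, languageOfLength]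
  exact ⟨fun h => ⟨h.1.2, h.2⟩, fun h => ⟨⟨language_of_cons h.2, h.1⟩, h.2⟩⟩

/-- Memory `k`: whether `i` may precede a long word depends only on its first `k` letters. -/
theorem IsStepSFT.take_mem_followers (hΛ : IsStepSFT k Λ) {i : Fin d} {α : List (Fin d)}
    (hα : α ∈ language Λ) (hk : k ≤ α.length) :
    α.take k ∈ followers Λ i k ↔ i :: α ∈ language Λ := by
  rw [mem_followers]
  have hl : (α.take k).length = k := by simp [hk]
  refine ⟨fun h => ?_, fun h => ⟨hl, ?_⟩⟩
  · have := hΛ.cons_append_mem hl h.2 (γ := α.drop k) (by rwa [List.take_append_drop])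
    rwa [List.take_append_drop] at this
  · refine language_of_append_left (β := α.drop k) ?_
    rwa [List.cons_append, List.take_append_drop]

/-- All words of length `n`. -/
def words (d n : ℕ) : Finset (List (Fin d)) := (List.finite_length_eq (Fin d) n).toFinset

@[simp] theorem mem_words {n : ℕ} {α : List (Fin d)} : α ∈ words d n ↔ α.length = n := by
  simp [words]

theorem words_zero : words d 0 = {[]} := by
  ext; simp

theorem sum_words_succ {M : Type*} [AddCommMonoid M] (n : ℕ) (f : List (Fin d) → M) :
    ∑ α ∈ words d (n + 1), f α = ∑ i, ∑ α ∈ words d n, f (i :: α) := by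
  rw [← Finset.sum_product']
  symm
  refine Finset.sum_bij (fun p _ => p.1 :: p.2) ?_ ?_ ?_ ?_
  · simp
  · rintro ⟨i, α⟩ _ ⟨j, β⟩ _ h
    simpa using h
  · rintro (_ | ⟨i, α⟩) h
    · simp at h
    · exact ⟨(i, α), by simpa using h, rfl⟩
  · simp

/-! ### The orthogonal family of word vectors in the Fock space -/

variable (Λ) in
/-- The vector `e_α` of `𝔉_X`, which is `0` if `α ≠ ∅` does not occur in `Λ`. -/
def wordVec (α : List (Fin d)) : Fock Λ := fockProj Λ (e α)

/-- The vacuum needs separate treatment: when `Λ` is empty, the empty word is not in the language,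
yet `X(0) = ℂ`. -/
theorem e_nil_mem_fock : e [] ∈ fockSubspace Λ :=
  Submodule.le_topologicalClosure _
    (Submodule.mem_iSup_of_mem 0 (Submodule.subset_span ⟨_, rfl, rfl⟩))

theorem fockIncl_wordVec {α : List (Fin d)} (h : α ∈ language Λ ∨ α = []) :
    fockIncl Λ (wordVec Λ α) = e α := by
  refine Submodule.starProjection_eq_self_iff.mpr ?_
  rcases h with h | rfl
  · exact e_mem_fock Λ h
  · exact e_nil_mem_fock

theorem wordVec_eq_zero {α : List (Fin d)} (h : α ∉ language Λ) (hne : α ≠ []) :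
    wordVec Λ α = 0 :=
  Submodule.orthogonalProjectionOnto_apply_of_mem_orthogonal (e_mem_fock_orthogonal Λ h hne)

theorem wordVec_cons_eq_zero {i : Fin d} {α : List (Fin d)} (h : i :: α ∉ language Λ) :
    wordVec Λ (i :: α) = 0 := wordVec_eq_zero h (List.cons_ne_nil _ _)

theorem inner_wordVec_of_ne {α β : List (Fin d)} (h : α ≠ β) :
    inner ℂ (wordVec Λ α) (wordVec Λ β) = 0 := by
  by_cases hα : α ∈ language Λ ∨ α = []
  · by_cases hβ : β ∈ language Λ ∨ β = []
    · rw [← (fockIncl Λ).inner_map_map, fockIncl_wordVec hα, fockIncl_wordVec hβ]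
      exact (orthonormal_e d).2 h
    · rw [not_or] at hβ
      rw [wordVec_eq_zero hβ.1 hβ.2, inner_zero_right]
  · rw [not_or] at hα
    rw [wordVec_eq_zero hα.1 hα.2, inner_zero_left]

theorem norm_wordVec {α : List (Fin d)} (h : α ∈ language Λ ∨ α = []) : ‖wordVec Λ α‖ = 1 := by
  rw [← (fockIncl Λ).norm_map, fockIncl_wordVec h]
  exact (orthonormal_e d).1 α

theorem fockIncl_inner_wordVec (α : List (Fin d)) (x : Fock Λ) :
    inner ℂ (wordVec Λ α) x = inner ℂ (e α) (fockIncl Λ x) :=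
  Submodule.inner_orthogonalProjectionOnto_eq_of_mem_right x (e α)

theorem dense_span_wordVec :
    (Submodule.span ℂ (Set.range (wordVec Λ))).topologicalClosure = ⊤ := by
  rw [Submodule.topologicalClosure_eq_top_iff, Submodule.eq_bot_iff]
  intro x hx
  have h0 : ∀ α, inner ℂ (e α) (fockIncl Λ x) = 0 := fun α => by
    rw [← fockIncl_inner_wordVec]
    exact hx _ (Submodule.subset_span ⟨α, rfl⟩)
  apply (fockIncl Λ).injective
  rw [map_zero]
  ext α
  have := h0 α
  rw [e, lp.inner_single_left] at this
  simpa using this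

theorem ext_wordVec {A B : FockOp Λ} (h : ∀ α, A (wordVec Λ α) = B (wordVec Λ α)) : A = B :=
  ContinuousLinearMap.ext_on (s := Set.range (wordVec Λ))
    (Submodule.dense_iff_topologicalClosure_eq_top.mpr dense_span_wordVec)
    (by rintro _ ⟨α, rfl⟩; exact h α)

@[simp] theorem xShift_wordVec (i : Fin d) (α : List (Fin d)) :
    xShift Λ i (wordVec Λ α) = wordVec Λ (i :: α) := by
  by_cases h : α ∈ language Λ ∨ α = []
  · have := xShift_apply Λ i α _ (fockIncl_wordVec h)
    split_ifs at this with hi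
    · rw [← fockIncl_wordVec (Or.inl hi)] at this
      exact (fockIncl Λ).injective this
    · rw [wordVec_cons_eq_zero hi]
      exact (fockIncl Λ).injective (by rw [this, map_zero])
  · rw [not_or] at h
    rw [wordVec_eq_zero h.1 h.2, map_zero,
      wordVec_cons_eq_zero (fun hi => h.1 (language_of_cons hi))]

theorem ext_inner_wordVec {x y : Fock Λ}
    (h : ∀ α, inner ℂ (wordVec Λ α) x = inner ℂ (wordVec Λ α) y) : x = y := by
  have hx : x - y ∈ (Submodule.span ℂ (Set.range (wordVec Λ)))ᗮ := by
    rw [Submodule.mem_orthogonal]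
    intro u hu
    induction hu using Submodule.span_induction with
    | mem u hu => obtain ⟨α, rfl⟩ := hu; rw [inner_sub_right, h, sub_self]
    | zero => simp
    | add u v _ _ hu hv => rw [inner_add_left, hu, hv, add_zero]
    | smul c u _ hu => rw [inner_smul_left, hu, mul_zero]
  rw [Submodule.topologicalClosure_eq_top_iff.mp dense_span_wordVec, Submodule.mem_bot] at hx
  exact sub_eq_zero.mp hx

theorem inner_wordVec_star_xShift (i : Fin d) (α : List (Fin d)) (x : Fock Λ) :
    inner ℂ (wordVec Λ α) (star (xShift Λ i) x) = inner ℂ (wordVec Λ (i :: α)) x := by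
  rw [ContinuousLinearMap.star_eq_adjoint, ContinuousLinearMap.adjoint_inner_right, xShift_wordVec]

@[simp] theorem star_xShift_wordVec_nil (i : Fin d) : star (xShift Λ i) (wordVec Λ []) = 0 :=
  ext_inner_wordVec fun α => by
    rw [inner_wordVec_star_xShift, inner_wordVec_of_ne (by simp), inner_zero_right]

theorem star_xShift_wordVec_cons_of_ne {i j : Fin d} (h : i ≠ j) (α : List (Fin d)) :
    star (xShift Λ i) (wordVec Λ (j :: α)) = 0 :=
  ext_inner_wordVec fun β => by
    rw [inner_wordVec_star_xShift, inner_wordVec_of_ne (by simp [h]), inner_zero_right]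

theorem star_xShift_wordVec_cons_self {i : Fin d} {α : List (Fin d)} (h : i :: α ∈ language Λ) :
    star (xShift Λ i) (wordVec Λ (i :: α)) = wordVec Λ α :=
  ext_inner_wordVec fun β => by
    rw [inner_wordVec_star_xShift]
    by_cases hβ : β = α
    · subst hβ
      rw [inner_self_eq_norm_sq_to_K, inner_self_eq_norm_sq_to_K, norm_wordVec (.inl h),
        norm_wordVec (.inl (language_of_cons h))]
    · rw [inner_wordVec_of_ne (by simpa using hβ), inner_wordVec_of_ne hβ]

/-! ### The relations for the `X`-shift modulo compact operators -/

theorem wordProd_cons {A : Type*} [Monoid A] (T : Fin d → A) (i : Fin d) (α : List (Fin d)) :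
    wordProd T (i :: α) = T i * wordProd T α := by simp [wordProd]

theorem wordProd_append {A : Type*} [Monoid A] (T : Fin d → A) (α β : List (Fin d)) :
    wordProd T (α ++ β) = wordProd T α * wordProd T β := by simp [wordProd]

theorem wordProd_nil {A : Type*} [Monoid A] (T : Fin d → A) : wordProd T [] = 1 := rfl

theorem map_wordProd {A B F : Type*} [Monoid A] [Monoid B] [FunLike F A B] [MonoidHomClass F A B]
    (φ : F) (T : Fin d → A) (α : List (Fin d)) :
    φ (wordProd T α) = wordProd (fun i => φ (T i)) α := by
  simp [wordProd, map_list_prod, Function.comp_def]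

theorem basisFreeMonoid_apply (α : FreeMonoid (Fin d)) :
    FreeAlgebra.basisFreeMonoid ℂ (Fin d) α
      = wordProd (FreeAlgebra.ι ℂ) (FreeMonoid.toList α) := by
  have h : FreeAlgebra.basisFreeMonoid ℂ (Fin d) α
      = FreeAlgebra.equivMonoidAlgebraFreeMonoid.symm (MonoidAlgebra.single α (1 : ℂ)) := by
    simp [FreeAlgebra.basisFreeMonoid]
  rw [h]
  simp [FreeAlgebra.equivMonoidAlgebraFreeMonoid, FreeMonoid.lift_apply, wordProd]

theorem lift_basisFreeMonoid {A : Type*} [Ring A] [Algebra ℂ A] (T : Fin d → A)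
    (α : FreeMonoid (Fin d)) :
    FreeAlgebra.lift ℂ T (FreeAlgebra.basisFreeMonoid ℂ (Fin d) α)
      = wordProd T (FreeMonoid.toList α) := by
  rw [basisFreeMonoid_apply, map_wordProd]
  simp

theorem polyVector_apply (p : FreeAlgebra ℂ (Fin d)) (α : List (Fin d)) :
    polyVector d p α = (FreeAlgebra.basisFreeMonoid ℂ (Fin d)).repr p (FreeMonoid.ofList α) := by
  let b := FreeAlgebra.basisFreeMonoid ℂ (Fin d)
  have key : (lp.evalₗ (E := fun _ : List (Fin d) => ℂ) (𝕜 := ℂ) 2 α) ∘ₗ polyVector d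
      = b.coord (FreeMonoid.ofList α) := by
    refine b.ext fun β => ?_
    rw [LinearMap.comp_apply, polyVector, Module.Basis.constr_basis, Module.Basis.coord_apply,
      Module.Basis.repr_self]
    change (e (FreeMonoid.toList β) : FullFock d) α = _
    rw [e, lp.coeFn_single]
    by_cases h : FreeMonoid.ofList α = β
    · subst h
      rw [Finsupp.single_eq_same]
      exact Pi.single_eq_same _ _
    · rw [Finsupp.single_eq_of_ne h, Pi.single_eq_of_ne]
      rintro rfl
      exact h rfl
  exact LinearMap.congr_fun key p

theorem wordProd_xShift_wordVec (α β : List (Fin d)) :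
    wordProd (xShift Λ) α (wordVec Λ β) = wordVec Λ (α ++ β) := by
  induction α with
  | nil => simp [wordProd]
  | cons i α ih => rw [wordProd_cons, mul_apply_eq_comp, ih, xShift_wordVec]; rfl

/-- `S^α (S^α)^*` strips the prefix `α` and puts it back, so it is the projection onto the words
that begin with `α`. -/
theorem wordProd_mul_star_xShift_wordVec [DecidableEq (List (Fin d))] (α β : List (Fin d)) :
    (wordProd (xShift Λ) α * star (wordProd (xShift Λ) α)) (wordVec Λ β)
      = if α <+: β then wordVec Λ β else 0 := by
  induction α generalizing β with
  | nil => simp [wordProd]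
  | cons i α ih =>
    rw [wordProd_cons, star_mul,
      show ∀ s w : FockOp Λ, s * w * (star w * star s) = s * (w * star w) * star s by
        intro s w; simp only [mul_assoc],
      mul_apply_eq_comp, mul_apply_eq_comp]
    cases β with
    | nil => simp
    | cons j β =>
      by_cases hij : i = j
      · subst hij
        by_cases hl : i :: β ∈ language Λ
        · rw [star_xShift_wordVec_cons_self hl, ih]
          by_cases h : α <+: β <;> simp [h]
        · simp [wordVec_cons_eq_zero hl]
      · rw [star_xShift_wordVec_cons_of_ne hij]
        simp [hij]

/-- The range lies in the span of the images of the finitely many short words, so `D` has finite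
rank. -/
theorem isCompactOperator_of_wordVec_eq_zero {D : FockOp Λ} (n : ℕ)
    (hD : ∀ β : List (Fin d), n ≤ β.length → D (wordVec Λ β) = 0) : IsCompactOperator D := by
  let F : Submodule ℂ (Fock Λ) :=
    Submodule.span ℂ ((fun β => D (wordVec Λ β)) '' {β | β.length < n})
  have : FiniteDimensional ℂ F :=
    FiniteDimensional.span_of_finite ℂ ((List.finite_length_lt (Fin d) n).image _)
  have hF : ∀ x, D x ∈ F := by
    intro x
    have hx : x ∈ (Submodule.span ℂ (Set.range (wordVec Λ))).topologicalClosure := by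
      rw [dense_span_wordVec]; trivial
    have hle : (Submodule.span ℂ (Set.range (wordVec Λ))).topologicalClosure
        ≤ F.comap (D : Fock Λ →ₗ[ℂ] Fock Λ) := by
      refine Submodule.topologicalClosure_minimal _ ?_
        (F.closed_of_finiteDimensional.preimage D.continuous)
      rw [Submodule.span_le]
      rintro _ ⟨β, rfl⟩
      by_cases hβ : β.length < n
      · exact Submodule.subset_span ⟨β, hβ, rfl⟩
      · change D _ ∈ F
        rw [hD β (not_lt.mp hβ)]
        exact F.zero_mem
    exact hle hx
  have hc : IsCompactOperator (D.codRestrict F hF) :=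
    haveI : ProperSpace F := FiniteDimensional.proper ℂ F
    isCompactOperator_of_locallyCompactSpace_dom _
  exact hc.clm_comp F.subtypeL

/-- `I^X` is a monomial ideal: a polynomial with `p(e) ∈ E^{⊗n} ⊖ X(n)` involves only words of
length `n` outside the language. Thus (Z1) reduces to the vanishing of `T^α` on nonempty forbidden
words. -/
theorem lift_eq_zero_of_mem_idealOf {A : Type*} [Ring A] [Algebra ℂ A] {T : Fin d → A}
    (hT : ∀ α, α ∉ language Λ → α ≠ [] → wordProd T α = 0) {p : FreeAlgebra ℂ (Fin d)}
    (hp : p ∈ idealOf Λ) : FreeAlgebra.lift ℂ T p = 0 := by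
  induction hp using Submodule.span_induction with
  | zero => simp
  | add x y _ _ hx hy => rw [map_add, hx, hy, add_zero]
  | smul c x _ hx => rw [map_smul, hx, smul_zero]
  | mem p hp =>
    obtain ⟨n, hn, hpt, hpf⟩ := hp
    have h0 : ∀ α : List (Fin d), (α.length ≠ n ∨ α ∈ language Λ) → polyVector d p α = 0 := by
      intro α hα
      have hpe : polyVector d p α = inner ℂ (e α) (polyVector d p) := by
        rw [e, lp.inner_single_left]
        simp
      rw [hpe]
      by_cases hl : α.length = n
      · obtain ⟨m, rfl⟩ := Nat.exists_eq_succ_of_ne_zero hn.ne'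
        exact hpf _ (Submodule.subset_span ⟨α, ⟨hα.resolve_left (not_not.mpr hl), hl⟩, rfl⟩)
      · refine Submodule.span_induction ?_ (by simp) ?_ ?_ hpt
        · rintro _ ⟨β, hβ, rfl⟩
          exact (orthonormal_e d).2 (fun h => hl (h ▸ hβ))
        · intro x y _ _ hx hy
          rw [inner_add_right, hx, hy, add_zero]
        · intro c x _ hx
          rw [inner_smul_right, hx, mul_zero]
    rw [← (FreeAlgebra.basisFreeMonoid ℂ (Fin d)).linearCombination_repr p,
      Finsupp.linearCombination_apply, Finsupp.sum, map_sum]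
    refine Finset.sum_eq_zero fun α _ => ?_
    rw [map_smul, lift_basisFreeMonoid]
    by_cases hα : (FreeMonoid.toList α).length ≠ n ∨ FreeMonoid.toList α ∈ language Λ
    · have := h0 _ hα
      rw [polyVector_apply] at this
      rw [FreeMonoid.ofList_toList] at this
      rw [this, zero_smul]
    · rw [not_or, not_not] at hα
      rw [hT _ hα.2 (fun h => by rw [h] at hα; simp at hα; omega), smul_zero]

theorem basisFreeMonoid_mem_idealOf {α : List (Fin d)} (h : α ∉ language Λ) (hne : α ≠ []) :
    FreeAlgebra.basisFreeMonoid ℂ (Fin d) (FreeMonoid.ofList α) ∈ idealOf Λ := by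
  refine Submodule.subset_span ⟨α.length, List.length_pos_iff.mpr hne, ?_⟩
  rw [polyVector, Module.Basis.constr_basis, FreeMonoid.toList_ofList]
  refine ⟨Submodule.subset_span ⟨α, rfl, rfl⟩, ?_⟩
  refine Submodule.orthogonal_le ?_ (e_mem_fock_orthogonal Λ h hne)
  exact (le_iSup (fiber Λ) _).trans (Submodule.le_topologicalClosure _)

theorem wordProd_eq_zero_of_ideal {A : Type*} [Ring A] [Algebra ℂ A] {T : Fin d → A}
    (hT : ∀ p ∈ idealOf Λ, FreeAlgebra.lift ℂ T p = 0) {α : List (Fin d)} (h : α ∉ language Λ)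
    (hne : α ≠ []) : wordProd T α = 0 := by
  have := hT _ (basisFreeMonoid_mem_idealOf h hne)
  rwa [lift_basisFreeMonoid] at this

theorem wordProd_xShift_eq_zero {α : List (Fin d)} (h : α ∉ language Λ) (hne : α ≠ []) :
    wordProd (xShift Λ) α = 0 :=
  ext_wordVec fun β => by
    rw [wordProd_xShift_wordVec, wordVec_eq_zero (fun h' => h (language_of_append_left h'))
      (by simp [hne])]
    rfl

theorem star_xShift_mul_xShift_of_ne {i j : Fin d} (h : i ≠ j) :
    star (xShift Λ i) * xShift Λ j = 0 :=
  ext_wordVec fun β => by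
    rw [mul_apply_eq_comp, xShift_wordVec, star_xShift_wordVec_cons_of_ne h]
    rfl

/-- Every nonempty word has exactly one first letter, so the relation fails only on the vacuum. -/
theorem isCompactOperator_sum_xShift_mul_star_sub_one :
    IsCompactOperator (∑ i, xShift Λ i * star (xShift Λ i) - 1 : FockOp Λ) := by
  classical
  refine isCompactOperator_of_wordVec_eq_zero 1 fun β hβ => ?_
  obtain ⟨j, β, rfl⟩ := List.exists_cons_of_length_pos hβ
  have h : ∀ i, (xShift Λ i * star (xShift Λ i)) (wordVec Λ (j :: β))
      = if i = j then wordVec Λ (j :: β) else 0 := fun i => by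
    have := wordProd_mul_star_xShift_wordVec (Λ := Λ) [i] (j :: β)
    simpa [wordProd] using this
  rw [sub_apply, sum_apply]
  simp [h]

theorem isCompactOperator_star_xShift_mul_sub (hΛ : IsStepSFT k Λ) (i : Fin d) :
    IsCompactOperator (star (xShift Λ i) * xShift Λ i
      - ∑ α ∈ followers Λ i k, wordProd (xShift Λ) α * star (wordProd (xShift Λ) α)
        : FockOp Λ) := by
  classical
  -- The `1` matters for `k = 0`: a word outside the language has zero vector only if it is
  -- nonempty.
  refine isCompactOperator_of_wordVec_eq_zero (max k 1) fun β hβ => ?_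
  rw [max_le_iff] at hβ
  by_cases hl : β ∈ language Λ
  · rw [sub_apply, sum_apply, sub_eq_zero]
    simp only [wordProd_mul_star_xShift_wordVec]
    -- Only one word of length `k` is a prefix of `β`, so the sum of projections reduces to the test
    -- whether `β.take k` may follow `i`.
    have hpre : ∀ α ∈ followers Λ i k, (α <+: β ↔ α = β.take k) := fun α hα => by
      rw [List.prefix_iff_eq_take, (mem_followers.mp hα).1]
    rw [Finset.sum_congr rfl fun α hα => if_congr (hpre α hα) rfl rfl, Finset.sum_ite_eq',
      mul_apply_eq_comp, xShift_wordVec]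
    simp only [hΛ.take_mem_followers hl hβ.1]
    split_ifs with h
    · exact star_xShift_wordVec_cons_self h
    · rw [wordVec_cons_eq_zero h, map_zero]
  · rw [wordVec_eq_zero hl (List.length_pos_iff.mp hβ.2), map_zero]

theorem quotientMap_eq_of_isCompactOperator {K : Type*} [NormedAddCommGroup K]
    [InnerProductSpace ℂ K] [CompleteSpace K] {A : StarSubalgebra ℂ (K →L[ℂ] K)} {a b : A}
    (h : IsCompactOperator ((a : K →L[ℂ] K) - b : K →L[ℂ] K)) :
    quotientMap A a = quotientMap A b :=
  Ideal.Quotient.eq.mpr h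

variable (Λ) in
/-- The `X`-shift as a family of elements of the Toeplitz algebra. -/
def toeplitzShift (i : Fin d) : toeplitz Λ := ⟨xShift Λ i, mem_generatedCStar (xShift Λ) i⟩

theorem coe_wordProd_toeplitzShift (α : List (Fin d)) :
    ((wordProd (toeplitzShift Λ) α : toeplitz Λ) : FockOp Λ) = wordProd (xShift Λ) α :=
  map_wordProd (toeplitz Λ).subtype _ α

theorem wordProd_Z (α : List (Fin d)) :
    wordProd (Z Λ) α = quotientMap (toeplitz Λ) (wordProd (toeplitzShift Λ) α) :=
  (map_wordProd (quotientMap (toeplitz Λ)) _ α).symm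

/-- The generators of `O_Λ` satisfy the relations (Z1)-(Z4). -/
theorem satisfiesRelations_Z (hΛ : IsStepSFT k Λ) : SatisfiesRelations Λ k (Z Λ) where
  ideal_eq_zero p hp := by
    refine lift_eq_zero_of_mem_idealOf (fun α hα hne => ?_) hp
    rw [wordProd_Z, show wordProd (toeplitzShift Λ) α = 0 from Subtype.ext <| by
      rw [coe_wordProd_toeplitzShift, wordProd_xShift_eq_zero hα hne]; rfl, map_zero]
  star_mul_eq_zero i j hij := by
    change star (quotientMap _ (toeplitzShift Λ i)) * quotientMap _ (toeplitzShift Λ j) = 0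
    rw [← quotientMap_star, ← map_mul,
      show star (toeplitzShift Λ i) * toeplitzShift Λ j = 0 from
        Subtype.ext (star_xShift_mul_xShift_of_ne hij), map_zero]
  sum_mul_star := by
    change ∑ i, quotientMap _ (toeplitzShift Λ i) * star (quotientMap _ (toeplitzShift Λ i)) = 1
    simp only [← quotientMap_star, ← map_mul, ← map_sum]
    rw [← map_one (quotientMap (toeplitz Λ))]
    apply quotientMap_eq_of_isCompactOperator
    have := isCompactOperator_sum_xShift_mul_star_sub_one (Λ := Λ)
    rw [AddSubmonoidClass.coe_finsetSum]
    exact this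
  star_mul_self i := by
    change star (quotientMap _ (toeplitzShift Λ i)) * quotientMap _ (toeplitzShift Λ i) = _
    simp only [wordProd_Z, ← quotientMap_star, ← map_mul, ← map_sum]
    apply quotientMap_eq_of_isCompactOperator
    have := isCompactOperator_star_xShift_mul_sub hΛ i
    simp only [← coe_wordProd_toeplitzShift] at this
    rw [AddSubmonoidClass.coe_finsetSum]
    exact this

theorem SatisfiesRelations.map {A B F : Type*} [Ring A] [Algebra ℂ A] [Star A] [Ring B]
    [Algebra ℂ B] [Star B] [FunLike F A B] [AlgHomClass F ℂ A B] [StarHomClass F A B]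
    {T : Fin d → A} (hT : SatisfiesRelations Λ k T) (φ : F) :
    SatisfiesRelations Λ k (fun i => φ (T i)) where
  ideal_eq_zero p hp := by
    refine lift_eq_zero_of_mem_idealOf (fun α hα hne => ?_) hp
    rw [← map_wordProd, wordProd_eq_zero_of_ideal hT.ideal_eq_zero hα hne, map_zero]
  star_mul_eq_zero i j hij := by
    rw [← map_star, ← map_mul, hT.star_mul_eq_zero i j hij, map_zero]
  sum_mul_star := by
    simp only [← map_star, ← map_mul, ← map_sum, hT.sum_mul_star, map_one]
  star_mul_self i := by
    simp only [← map_wordProd, ← map_star, ← map_mul, ← map_sum, hT.star_mul_self]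

/-! ### Consequences of the relations -/

section Relations

variable {A : Type*} [Ring A] [Algebra ℂ A] [StarRing A] {T : Fin d → A}

theorem SatisfiesRelations.wordProd_eq_zero (hT : SatisfiesRelations Λ k T) {α : List (Fin d)}
    (h : α ∉ language Λ) (hne : α ≠ []) : wordProd T α = 0 :=
  wordProd_eq_zero_of_ideal hT.ideal_eq_zero h hne

/-- Iterating (Z3): the sum for length `n + 1` is `∑ T_i (⋯) T_i^*` with the sum for length `n`
inside. -/
theorem SatisfiesRelations.sum_words (hT : SatisfiesRelations Λ k T) (n : ℕ) :
    ∑ α ∈ words d n, wordProd T α * star (wordProd T α) = 1 := by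
  induction n with
  | zero => simp [words_zero, wordProd_nil]
  | succ n ih =>
    rw [sum_words_succ, ← hT.sum_mul_star]
    refine Finset.sum_congr rfl fun i _ => ?_
    have : ∀ α ∈ words d n, wordProd T (i :: α) * star (wordProd T (i :: α))
        = T i * (wordProd T α * star (wordProd T α)) * star (T i) := fun α _ => by
      rw [wordProd_cons, star_mul]
      simp only [mul_assoc]
    rw [Finset.sum_congr rfl this, ← Finset.sum_mul, ← Finset.mul_sum, ih, mul_one]

/-- Different first letters are handled by (Z2). For equal ones, (Z4) inserts terms `T^γ (T^γ)^*`
with `|γ| = k` between the tails. As the tails differ, the prefix of `γ` of their length differs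
from one of them, and induction kills the term. The bound `m ≤ k` ensures that `γ` is long enough.
-/
theorem SatisfiesRelations.star_wordProd_mul_wordProd (hT : SatisfiesRelations Λ k T) {m : ℕ}
    (hm : m ≤ k) {α β : List (Fin d)} (hα : α.length = m) (hβ : β.length = m) (h : β ≠ α) :
    star (wordProd T β) * wordProd T α = 0 := by
  induction m generalizing α β with
  | zero =>
    rw [List.length_eq_zero_iff] at hα hβ
    exact absurd (hβ.trans hα.symm) h
  | succ m ih =>
    obtain ⟨i, α, rfl⟩ := List.exists_cons_of_length_eq_add_one hα
    obtain ⟨j, β, rfl⟩ := List.exists_cons_of_length_eq_add_one hβ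
    simp only [List.length_cons, Nat.add_right_cancel_iff] at hα hβ
    rw [wordProd_cons, wordProd_cons, star_mul, mul_assoc, ← mul_assoc (star (T j))]
    by_cases hij : j = i
    · subst hij
      have hne : β ≠ α := fun h' => h (by rw [h'])
      rw [hT.star_mul_self, Finset.sum_mul, Finset.mul_sum]
      refine Finset.sum_eq_zero fun γ hγ => ?_
      have hγl := (mem_followers.mp hγ).1
      have hγ' : wordProd T γ = wordProd T (γ.take m) * wordProd T (γ.drop m) := by
        rw [← wordProd_append, List.take_append_drop]
      have htl : (γ.take m).length = m := by
        rw [List.length_take, hγl]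
        omega
      by_cases hb : β = γ.take m
      · have := ih (by omega) hα htl (fun h' => hne (hb.trans h'))
        rw [hγ', star_mul, mul_assoc, mul_assoc, mul_assoc, this]
        simp
      · have := ih (by omega) htl hβ hb
        rw [hγ', ← mul_assoc, ← mul_assoc, ← mul_assoc, this]
        simp
    · rw [hT.star_mul_eq_zero j i hij]
      simp

/-- Put `α' = α.take k`. Applied to `T^{α'}`, the sum (Z4) over `E_i^k` and the sum over all words
of length `k` both collapse, by orthogonality, to their `α'` term; the latter sum is `1`. -/
theorem SatisfiesRelations.star_mul_self_mul_wordProd (hT : SatisfiesRelations Λ k T) {i : Fin d}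
    {α : List (Fin d)} (hα : k ≤ α.length) (h : i :: α ∈ language Λ) :
    star (T i) * T i * wordProd T α = wordProd T α := by
  have hl : (α.take k).length = k := by simp [hα]
  have hmem : α.take k ∈ followers Λ i k := by
    refine mem_followers.mpr ⟨hl, language_of_append_left (β := α.drop k) ?_⟩
    rwa [List.cons_append, List.take_append_drop]
  suffices key : star (T i) * T i * wordProd T (α.take k) = wordProd T (α.take k) by
    rw [← List.take_append_drop k α, wordProd_append, ← mul_assoc, key]
  have hs : ∀ s : Finset (List (Fin d)), (∀ β ∈ s, β.length = k) → α.take k ∈ s →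
      (∑ β ∈ s, wordProd T β * star (wordProd T β)) * wordProd T (α.take k)
        = wordProd T (α.take k) * star (wordProd T (α.take k)) * wordProd T (α.take k) := by
    intro s hs hmem
    rw [Finset.sum_mul]
    refine Finset.sum_eq_single_of_mem _ hmem fun β hβ hne => ?_
    rw [mul_assoc, hT.star_wordProd_mul_wordProd le_rfl hl (hs β hβ) hne, mul_zero]
  rw [hT.star_mul_self, hs _ (fun β hβ => (mem_followers.mp hβ).1) hmem,
    ← hs (words d k) (fun β hβ => mem_words.mp hβ) (mem_words.mpr hl), hT.sum_words, one_mul]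

end Relations

/-! ### The isometries into `𝔉_X ⊗ H` -/

section Blocks

variable {H : Type*} [NormedAddCommGroup H] [InnerProductSpace ℂ H] [CompleteSpace H]
  {T : Fin d → H →L[ℂ] H}

variable (Λ T) in
/-- The map `h ↦ ∑ e_α ⊗ (T^α)^* h`, where `α` ranges over the words of length `n`. -/
def block (n : ℕ) : H →ₗ[ℂ] Fock Λ ⊗[ℂ] H :=
  ∑ α ∈ words d n, TensorProduct.mk ℂ (Fock Λ) H (wordVec Λ α)
    ∘ₗ (star (wordProd T α) : H →L[ℂ] H).toLinearMap

theorem block_apply (n : ℕ) (h : H) :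
    block Λ T n h = ∑ α ∈ words d n, wordVec Λ α ⊗ₜ[ℂ] (star (wordProd T α) h) := by
  simp [block]

theorem block_succ_apply (n : ℕ) (h : H) :
    block Λ T (n + 1) h = ∑ i, ∑ α ∈ words d n,
      wordVec Λ (i :: α) ⊗ₜ[ℂ] (star (wordProd T α) (star (T i) h)) := by
  rw [block_apply, sum_words_succ]
  simp only [wordProd_cons, star_mul, mul_apply_eq_comp]

theorem inner_block_of_ne {m n : ℕ} (hmn : m ≠ n) (x y : H) :
    inner ℂ (block Λ T m x) (block Λ T n y) = 0 := by
  rw [block_apply, block_apply, sum_inner]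
  refine Finset.sum_eq_zero fun α hα => ?_
  rw [inner_sum]
  refine Finset.sum_eq_zero fun β hβ => ?_
  rw [TensorProduct.inner_tmul, inner_wordVec_of_ne, zero_mul]
  rintro rfl
  exact hmn ((mem_words.mp hα).symm.trans (mem_words.mp hβ))

/-- The vectors `e_α` are orthogonal, and those that vanish are paired with `T^α = 0`, so the norm
is computed by `∑ T^α (T^α)^* = 1`. -/
theorem inner_block_self (hT : SatisfiesRelations Λ k T) {n : ℕ} (hn : n ≠ 0) (x : H) :
    inner ℂ (block Λ T n x) (block Λ T n x) = inner ℂ x x := by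
  have h1 : inner ℂ (block Λ T n x) (block Λ T n x)
      = ∑ α ∈ words d n, inner ℂ x ((wordProd T α * star (wordProd T α)) x) := by
    rw [block_apply, sum_inner]
    refine Finset.sum_congr rfl fun α hα => ?_
    rw [inner_sum, Finset.sum_eq_single_of_mem α hα fun β _ hne => by
      rw [TensorProduct.inner_tmul, inner_wordVec_of_ne hne.symm, zero_mul]]
    rw [TensorProduct.inner_tmul]
    by_cases hl : α ∈ language Λ
    · rw [inner_self_eq_norm_sq_to_K, norm_wordVec (.inl hl), mul_apply_eq_comp,
        ContinuousLinearMap.star_eq_adjoint, ContinuousLinearMap.adjoint_inner_left]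
      simp
    · have hne : α ≠ [] := by
        rintro rfl
        exact hn (mem_words.mp hα).symm
      rw [hT.wordProd_eq_zero hl hne]
      simp
  rw [h1, ← inner_sum, ← sum_apply, hT.sum_words]
  rfl

/-- By (Z2) only words beginning with `i` survive on the right; on those, `(T^α)^* T_i^* T_i =
(T^α)^*` whenever `e_{iα} ≠ 0`. -/
theorem rTensor_xShift_block (hT : SatisfiesRelations Λ k T) {n : ℕ} (hn : k ≤ n) (i : Fin d)
    (h : H) : (xShift Λ i).rTensor H (block Λ T n h) = block Λ T (n + 1) (T i h) := by
  rw [block_succ_apply, Finset.sum_eq_single_of_mem i (Finset.mem_univ i), block_apply, map_sum]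
  · refine Finset.sum_congr rfl fun α hα => ?_
    rw [ContinuousLinearMap.rTensor_tmul, xShift_wordVec]
    by_cases hl : i :: α ∈ language Λ
    · have := congrArg star
        (hT.star_mul_self_mul_wordProd (hn.trans (mem_words.mp hα).ge) hl)
      rw [star_mul, star_mul, star_star] at this
      rw [← mul_apply_eq_comp, ← mul_apply_eq_comp, mul_assoc, this]
    · rw [wordVec_cons_eq_zero hl, TensorProduct.zero_tmul, TensorProduct.zero_tmul]
  · intro j _ hj
    rw [← mul_apply_eq_comp (star (T j)), hT.star_mul_eq_zero j i hj]
    simp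

/-- No lower bound on `n` is needed: if `iα` is forbidden, then `S_i^*` loses the term at `e_α`, but
there `(T^α)^* T_i^* = 0` by (Z1). -/
theorem rTensor_star_xShift_block (hT : SatisfiesRelations Λ k T) (n : ℕ) (i : Fin d) (h : H) :
    (star (xShift Λ i)).rTensor H (block Λ T (n + 1) h) = block Λ T n (star (T i) h) := by
  rw [block_succ_apply, map_sum, Finset.sum_eq_single_of_mem i (Finset.mem_univ i), block_apply,
    map_sum]
  · refine Finset.sum_congr rfl fun α _ => ?_
    rw [ContinuousLinearMap.rTensor_tmul]
    by_cases hl : i :: α ∈ language Λ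
    · rw [star_xShift_wordVec_cons_self hl]
    · have := congrArg star (hT.wordProd_eq_zero hl (List.cons_ne_nil _ _))
      rw [wordProd_cons, star_mul, star_zero] at this
      rw [← mul_apply_eq_comp, this]
      simp
  · intro j _ hj
    rw [map_sum]
    refine Finset.sum_eq_zero fun α _ => ?_
    rw [ContinuousLinearMap.rTensor_tmul, star_xShift_wordVec_cons_of_ne hj.symm,
      TensorProduct.zero_tmul]

/-! ### Averages of blocks and their asymptotic intertwining -/

variable (Λ k T) in
/-- The normalized sum of `N + 1` consecutive blocks, starting at length `N + k + 2`. -/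
def average (N : ℕ) : H →ₗ[ℂ] Fock Λ ⊗[ℂ] H :=
  (((√(N + 1 : ℝ))⁻¹ : ℝ) : ℂ) • ∑ n ∈ Finset.range (N + 1), block Λ T (N + k + 2 + n)

theorem average_apply (N : ℕ) (h : H) : average k Λ T N h
    = (((√(N + 1 : ℝ))⁻¹ : ℝ) : ℂ) •
      ∑ n ∈ Finset.range (N + 1), block Λ T (N + k + 2 + n) h := by
  simp [average]

theorem norm_average (hT : SatisfiesRelations Λ k T) (N : ℕ) (h : H) :
    ‖average k Λ T N h‖ = ‖h‖ := by
  have h1 : inner ℂ (∑ n ∈ Finset.range (N + 1), block Λ T (N + k + 2 + n) h)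
      (∑ n ∈ Finset.range (N + 1), block Λ T (N + k + 2 + n) h) = (N + 1 : ℂ) * inner ℂ h h := by
    rw [sum_inner, Finset.sum_congr rfl fun m hm => by
      rw [inner_sum, Finset.sum_eq_single_of_mem m hm fun n _ hne =>
        inner_block_of_ne (by omega) _ _, inner_block_self hT (by omega)]]
    simp
  have h2 : ‖∑ n ∈ Finset.range (N + 1), block Λ T (N + k + 2 + n) h‖ ^ 2
      = (N + 1) * ‖h‖ ^ 2 := by
    have h3 := (inner_self_eq_norm_sq_to_K (𝕜 := ℂ) (E := Fock Λ ⊗[ℂ] H) _).symm.trans h1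
    rw [inner_self_eq_norm_sq_to_K] at h3
    have h4 : ((‖∑ n ∈ Finset.range (N + 1), block Λ T (N + k + 2 + n) h‖ ^ 2 : ℝ) : ℂ)
        = (((N + 1) * ‖h‖ ^ 2 : ℝ) : ℂ) := by
      push_cast
      exact h3
    exact Complex.ofReal_injective h4
  have hpos : (0 : ℝ) < N + 1 := by positivity
  rw [← sq_eq_sq₀ (norm_nonneg _) (norm_nonneg _), average_apply, norm_smul, mul_pow, h2,
    Complex.norm_real, norm_inv, Real.norm_of_nonneg (Real.sqrt_nonneg _), inv_pow,
    Real.sq_sqrt hpos.le, inv_mul_cancel_left₀ hpos.ne']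

theorem norm_block (hT : SatisfiesRelations Λ k T) {n : ℕ} (hn : n ≠ 0) (x : H) :
    ‖block Λ T n x‖ = ‖x‖ := by
  have := (inner_self_eq_norm_sq_to_K (𝕜 := ℂ) (E := Fock Λ ⊗[ℂ] H) _).symm.trans
    (inner_block_self hT hn x)
  rw [inner_self_eq_norm_sq_to_K] at this
  rw [← sq_eq_sq₀ (norm_nonneg _) (norm_nonneg _)]
  exact_mod_cast this

theorem tendsto_inv_sqrt_succ_mul (c : ℝ) :
    Tendsto (fun N : ℕ => (√(N + 1 : ℝ))⁻¹ * c) atTop (𝓝 0) := by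
  have h1 : Tendsto (fun N : ℕ => (N + 1 : ℝ)) atTop atTop :=
    tendsto_atTop_add_const_right _ _ tendsto_natCast_atTop_atTop
  simpa using (tendsto_inv_atTop_zero.comp (Real.tendsto_sqrt_atTop.comp h1)).mul_const c

/-- Two blocks of norm `‖h‖` remain, so the norm is at most `2‖h‖ / √(N + 1)`. -/
theorem tendsto_zero_of_telescope (hT : SatisfiesRelations Λ k T) (h : H)
    (u : ℕ → Fock Λ ⊗[ℂ] H) (p q : ℕ → ℕ) (hp : ∀ N, p N ≠ 0) (hq : ∀ N, q N ≠ 0)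
    (hu : ∀ N : ℕ, u N = (((√(N + 1 : ℝ))⁻¹ : ℝ) : ℂ) • (block Λ T (p N) h - block Λ T (q N) h)) :
    Tendsto u atTop (𝓝 0) := by
  refine squeeze_zero_norm (fun N => ?_) (tendsto_inv_sqrt_succ_mul (‖h‖ + ‖h‖))
  rw [hu, norm_smul, Complex.norm_real, norm_inv, Real.norm_of_nonneg (Real.sqrt_nonneg _)]
  gcongr
  refine (norm_sub_le _ _).trans ?_
  rw [norm_block hT (hp N), norm_block hT (hq N)]

theorem starIntertwines_xShift (hT : SatisfiesRelations Λ k T) (i : Fin d) :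
    StarIntertwines (average k Λ T) (xShift Λ i) (T i) := by
  constructor
  · intro h
    refine tendsto_zero_of_telescope hT (T i h) _ (fun N => N + k + 2 + (N + 1))
      (fun N => N + k + 2) (by omega) (by omega) fun N => ?_
    rw [average_apply, average_apply, map_smul, map_sum, ← smul_sub, ← Finset.sum_sub_distrib]
    congr 1
    rw [Finset.sum_congr rfl fun n _ => by rw [rTensor_xShift_block hT (by omega)]]
    exact Finset.sum_range_sub (fun n => block Λ T (N + k + 2 + n) (T i h)) (N + 1)
  · intro h
    -- The adjoint lowers lengths by one. Starting the average at `N + k + 2` keeps the lowest block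
    -- at positive length, where it is isometric, even for `N = k = 0`.
    refine tendsto_zero_of_telescope hT (star (T i) h) _ (fun N => N + k + 1)
      (fun N => N + k + 1 + (N + 1)) (by omega) (by omega) fun N => ?_
    have hs : ∀ n, N + k + 2 + n = N + k + 1 + n + 1 := by omega
    rw [average_apply, average_apply, map_smul, map_sum, ← smul_sub, ← Finset.sum_sub_distrib]
    congr 1
    rw [Finset.sum_congr rfl fun n _ => by rw [hs, rTensor_star_xShift_block hT]]
    exact Finset.sum_range_sub' (fun n => block Λ T (N + k + 1 + n) (star (T i) h)) (N + 1)

/-! ### Compact operators are annihilated in the limit -/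

variable (Λ) in
/-- The span of the word vectors of length less than `N`. -/
def shortSpan (N : ℕ) : Submodule ℂ (Fock Λ) :=
  Submodule.span ℂ (wordVec Λ '' {α | α.length < N})

instance (N : ℕ) : FiniteDimensional ℂ (shortSpan Λ N) :=
  FiniteDimensional.span_of_finite ℂ ((List.finite_length_lt (Fin d) N).image _)

theorem tendsto_starProjection_shortSpan (x : Fock Λ) :
    Tendsto (fun N => (shortSpan Λ N).starProjection x) atTop (𝓝 x) := by
  refine Submodule.starProjection_tendsto_self _ (fun m n hmn => ?_) x ?_
  · exact Submodule.span_mono (Set.image_mono fun α hα => lt_of_lt_of_le hα hmn)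
  · rw [← dense_span_wordVec (Λ := Λ)]
    refine Submodule.topologicalClosure_mono (Submodule.span_le.mpr ?_)
    rintro _ ⟨α, rfl⟩
    exact Submodule.mem_iSup_of_mem (α.length + 1)
      (Submodule.subset_span ⟨α, Nat.lt_succ_self _, rfl⟩)

theorem starProjection_shortSpan_wordVec {N : ℕ} {α : List (Fin d)} (h : N ≤ α.length) :
    (shortSpan Λ N).starProjection (wordVec Λ α) = 0 := by
  rw [Submodule.starProjection_apply_eq_zero_iff, Submodule.mem_orthogonal]
  intro u hu
  refine Submodule.span_induction ?_ (by simp) ?_ ?_ hu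
  · rintro _ ⟨β, hβ, rfl⟩
    refine inner_wordVec_of_ne ?_
    rintro rfl
    exact absurd hβ (not_lt.mpr h)
  · intro x y _ _ hx hy
    rw [inner_add_left, hx, hy, add_zero]
  · intro c x _ hx
    rw [inner_smul_left, hx, mul_zero]

theorem rTensor_starProjection_average {n N : ℕ} (hn : n ≤ N) (h : H) :
    ((shortSpan Λ n).starProjection).rTensor H (average k Λ T N h) = 0 := by
  rw [average_apply, map_smul, map_sum, Finset.sum_eq_zero fun m _ => ?_, smul_zero]
  rw [block_apply, map_sum]
  refine Finset.sum_eq_zero fun α hα => ?_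
  have := mem_words.mp hα
  rw [ContinuousLinearMap.rTensor_tmul, starProjection_shortSpan_wordVec (by omega),
    TensorProduct.zero_tmul]

/-- A compact operator is approximated in norm by its corners on the short words. -/
theorem exists_norm_sub_mul_starProjection_le {a : FockOp Λ} (ha : IsCompactOperator a) {ε : ℝ}
    (hε : 0 < ε) : ∃ n, ‖a - a * (shortSpan Λ n).starProjection‖ ≤ ε := by
  -- It suffices to bound `a^* - P a^*`. The projections converge strongly to `1`, hence uniformly
  -- on a finite `ε/4`-net of the image of the unit ball under `a^*`.
  have hc := isCompactOperator_star ha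
  have htb : TotallyBounded ((star a : FockOp Λ) '' Metric.closedBall 0 1) :=
    (hc.isCompact_closure_image_closedBall (f := ((star a : FockOp Λ) : Fock Λ →ₗ[ℂ] Fock Λ))
      1).totallyBounded.subset subset_closure
  obtain ⟨t, htf, hcov⟩ := Metric.totallyBounded_iff.mp htb (ε / 4) (by positivity)
  have hev : ∀ᶠ n in atTop, ∀ y ∈ t, ‖y - (shortSpan Λ n).starProjection y‖ ≤ ε / 4 := by
    rw [eventually_all_finite htf]
    intro y _
    have h1 := ((tendsto_starProjection_shortSpan y).const_sub y).norm
    rw [sub_self, norm_zero] at h1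
    exact h1.eventually (ge_mem_nhds (by positivity))
  obtain ⟨n, hn⟩ := hev.exists
  refine ⟨n, ?_⟩
  set P : FockOp Λ := (shortSpan Λ n).starProjection with hP
  have hPs : star P = P := (isSelfAdjoint_starProjection (shortSpan Λ n)).star_eq
  have hPn : ‖P‖ ≤ 1 := Submodule.starProjection_norm_le _
  rw [← norm_star, star_sub, star_mul, hPs]
  refine ContinuousLinearMap.opNorm_le_of_unit_norm hε.le fun x hx => ?_
  obtain ⟨y, hy, hxy⟩ : ∃ y ∈ t, dist (star a x) y < ε / 4 := by
    simpa using hcov (Set.mem_image_of_mem _ (by simp [hx] : x ∈ Metric.closedBall 0 1))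
  rw [dist_eq_norm] at hxy
  have h1 : ‖P (star a x - y)‖ ≤ ε / 4 :=
    (P.le_of_opNorm_le hPn _).trans (by rw [one_mul]; exact hxy.le)
  have h2 : (star a - P * star a) x = (star a x - y) + (y - P y) + -(P (star a x - y)) := by
    rw [sub_apply, mul_apply_eq_comp, map_sub]
    abel
  rw [h2]
  refine norm_add₃_le.trans ?_
  rw [norm_neg]
  linarith [hn y hy]

theorem asympIntertwines_zero_of_isCompactOperator (hT : SatisfiesRelations Λ k T) {a : FockOp Λ}
    (ha : IsCompactOperator a) : AsympIntertwines (average k Λ T) a 0 := by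
  intro h
  rw [Metric.tendsto_atTop]
  intro ε hε
  -- The extra `1` covers `h = 0` and makes the final inequality strict.
  have hpos : 0 < ‖h‖ + 1 := by positivity
  obtain ⟨n, hn⟩ := exists_norm_sub_mul_starProjection_le ha (div_pos hε hpos)
  refine ⟨n, fun N hN => ?_⟩
  rw [dist_zero_right, zero_apply, map_zero, sub_zero]
  -- For `N ≥ n` the average contains no words of length less than `n`, so subtracting `a P_n`
  -- changes nothing and leaves an operator of small norm.
  have h1 : a.rTensor H (average k Λ T N h)
      = (a - a * (shortSpan Λ n).starProjection).rTensor H (average k Λ T N h) := by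
    rw [ContinuousLinearMap.rTensor_sub, ContinuousLinearMap.rTensor_mul, sub_apply,
      mul_apply_eq_comp, rTensor_starProjection_average hN, map_zero, sub_zero]
  rw [h1]
  calc _ ≤ ε / (‖h‖ + 1) * ‖average k Λ T N h‖ :=
        ContinuousLinearMap.le_of_opNorm_le _
          ((ContinuousLinearMap.norm_rTensor_le _ _).trans hn) _
    _ = ε * (‖h‖ / (‖h‖ + 1)) := by rw [norm_average hT]; ring
    _ < ε * 1 := by
        gcongr
        rw [div_lt_one hpos]
        linarith
    _ = ε := mul_one ε

end Blocks

/-! ### Representations of `O_Λ` -/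

section Representations

variable {H : Type*} [NormedAddCommGroup H] [InnerProductSpace ℂ H] [CompleteSpace H]

/-- Representations of a C*-algebra generated by operators are determined on the generators. -/
theorem starAlgHom_generatedCStar_ext {ι K : Type*} [NormedAddCommGroup K]
    [InnerProductSpace ℂ K] [CompleteSpace K] {S : ι → K →L[ℂ] K}
    {φ ψ : generatedCStar S →⋆ₐ[ℂ] (H →L[ℂ] H)}
    (h : ∀ i, φ ⟨S i, mem_generatedCStar S i⟩ = ψ ⟨S i, mem_generatedCStar S i⟩) : φ = ψ := by
  -- Closedness makes the generated algebra a C*-algebra, whose *-representations are automatically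
  -- continuous.
  have : IsClosed (generatedCStar S : Set (K →L[ℂ] K)) :=
    StarSubalgebra.isClosed_topologicalClosure _
  have hc : ∀ χ : generatedCStar S →⋆ₐ[ℂ] (H →L[ℂ] H), Continuous χ := fun χ => map_continuous χ
  refine StarAlgHom.ext_topologicalClosure (hc φ) (hc ψ) ?_
  refine StarAlgHom.ext_adjoin ?_
  rintro ⟨x, hx⟩ ⟨i, rfl⟩
  exact h i

/-- The quotient map `T_X → O_Λ` as a *-homomorphism. -/
def quotientStarMap {K : Type*} [NormedAddCommGroup K] [InnerProductSpace ℂ K] [CompleteSpace K]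
    (A : StarSubalgebra ℂ (K →L[ℂ] K)) : A →⋆ₐ[ℂ] ModCompact A :=
  { quotientMap A with map_star' := quotientMap_star A }

/-- Pulling back to `T_X` reduces uniqueness to the concrete C*-algebra, so no norm on the quotient
is required. -/
theorem starAlgHom_ext {π ρ : SubshiftAlg Λ →⋆ₐ[ℂ] (H →L[ℂ] H)}
    (h : ∀ i, π (Z Λ i) = ρ (Z Λ i)) : π = ρ := by
  have key : π.comp (quotientStarMap (toeplitz Λ)) = ρ.comp (quotientStarMap (toeplitz Λ)) :=
    starAlgHom_generatedCStar_ext h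
  refine StarAlgHom.ext fun x => ?_
  obtain ⟨a, rfl⟩ := quotientMap_surjective _ x
  exact DFunLike.congr_fun key a

/-- A *-homomorphism that vanishes on the compact operators factors through the quotient. -/
theorem exists_starAlgHom_modCompact {K B : Type*} [NormedAddCommGroup K]
    [InnerProductSpace ℂ K] [CompleteSpace K] {A : StarSubalgebra ℂ (K →L[ℂ] K)} [Ring B]
    [Algebra ℂ B] [Star B] (φ : A →⋆ₐ[ℂ] B)
    (hφ : ∀ a : A, IsCompactOperator (a : K →L[ℂ] K) → φ a = 0) :
    ∃ π : ModCompact A →⋆ₐ[ℂ] B, ∀ a, π (quotientMap A a) = φ a := by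
  let f : ModCompact A →ₐ[ℂ] B := Ideal.Quotient.liftₐ (compactIdeal A) φ.toAlgHom hφ
  have hf : ∀ a, f (quotientMap A a) = φ a := fun a => rfl
  refine ⟨{ f with map_star' := fun x => ?_ }, hf⟩
  obtain ⟨a, rfl⟩ := quotientMap_surjective A x
  change f _ = star (f _)
  rw [← quotientMap_star, hf, hf, map_star]

theorem exists_starAlgHom_of_satisfiesRelations {T : Fin d → H →L[ℂ] H}
    (hT : SatisfiesRelations Λ k T) :
    ∃ π : SubshiftAlg Λ →⋆ₐ[ℂ] (H →L[ℂ] H), ∀ i, π (Z Λ i) = T i := by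
  obtain ⟨φ, hφ, hφV⟩ := StarIntertwines.exists_starAlgHom (norm_average hT)
    (starIntertwines_xShift hT)
  -- For compact `a`, both `φ a` and `0` are asymptotically intertwined with `a ⊗ 1`, so they
  -- coincide.
  obtain ⟨π, hπ⟩ := exists_starAlgHom_modCompact (A := toeplitz Λ) φ fun a ha =>
    (hφV a).unique (norm_average hT) (asympIntertwines_zero_of_isCompactOperator hT ha)
  exact ⟨π, fun i => (hπ _).trans (hφ i)⟩

end Representations

end SubshiftAlgebra

end

theorem mainTheorem12 {d k : ℕ} (Λ : SymbolicDynamics.FullShift.Subshift (Fin d) ℤ)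
    (hΛ : SubshiftAlgebra.IsStepSFT k Λ)
    {H : Type*} [NormedAddCommGroup H] [InnerProductSpace ℂ H] [CompleteSpace H] :
    (∀ π : SubshiftAlgebra.SubshiftAlg Λ →⋆ₐ[ℂ] (H →L[ℂ] H),
      ∃ T : Fin d → H →L[ℂ] H,
        SubshiftAlgebra.IsRowContraction T ∧ SubshiftAlgebra.SatisfiesRelations Λ k T ∧
        (∀ i, π (SubshiftAlgebra.Z Λ i) = T i) ∧
        ∀ ρ : SubshiftAlgebra.SubshiftAlg Λ →⋆ₐ[ℂ] (H →L[ℂ] H),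
          (∀ i, ρ (SubshiftAlgebra.Z Λ i) = T i) → ρ = π) ∧
    (∀ T : Fin d → H →L[ℂ] H,
      SubshiftAlgebra.IsRowContraction T → SubshiftAlgebra.SatisfiesRelations Λ k T →
      ∃! π : SubshiftAlgebra.SubshiftAlg Λ →⋆ₐ[ℂ] (H →L[ℂ] H),
        ∀ i, π (SubshiftAlgebra.Z Λ i) = T i) := by
  refine ⟨fun π => ?_, fun T _ hT => ?_⟩
  · have hrel := (SubshiftAlgebra.satisfiesRelations_Z hΛ).map π
    exact ⟨fun i => π (SubshiftAlgebra.Z Λ i), hrel.sum_mul_star.le, hrel, fun i => rfl,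
      fun ρ hρ => SubshiftAlgebra.starAlgHom_ext hρ⟩
  · obtain ⟨π, hπ⟩ := SubshiftAlgebra.exists_starAlgHom_of_satisfiesRelations hT
    exact ⟨π, hπ, fun ρ hρ => SubshiftAlgebra.starAlgHom_ext fun i => (hρ i).trans (hπ i).symm⟩
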